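/- Let $G$ be a group, let $A$ be a finite set with a map $\pi\colon A\to G$, extended to a monoid homomorphism $\pi\colon A^*\to G$ on the free monoid $A^*$, and let $\mathcal L\subseteq A^*$. Suppose that $(A,\mathcal L)$ is a (uniformly finite-to-one) biautomatic structure on $G$, that is: $\pi\colon A^*\to G$ is surjective, $\pi(A)=\pi(A)^{-1}$ and $1_G\in\pi(A)$; the language $\mathcal L$ is recognised by a finite state automaton over $A$; there is $N\ge 1$ with $1\le|\pi^{-1}(g)\cap\mathcal L|\le N$ for every $g\in G$; and there is $\zeta\ge 1$ such that, whenever $p,q$ are paths in the Cayley graph $\mathrm{Cay}(G,A)$ labelled by words in $\mathcal L$ whose starting vertices are at distance at most $1$ and whose final vertices are at distance at most $1$ in the combinatorial metric $d_A$, one has $d_A(\widehat p(t),\widehat q(t))\le\zeta$ for all integers $t\ge 0$, where $\widehat p(t)$ is the $t$-th vertex of $p$ if $t$ is at most the length of $p$, and the final vertex of $p$ otherwise. For $g\in G$ let $|g|_{\mathcal L}$ be the length of a shortest word in $\mathcal L$ representing $g$, and let $\|g\|_{\mathcal L}=\min_{h\in G}|hgh^{-1}|_{\mathcal L}$ be the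 conjugacy $\mathcal L$-word length of $g$. Suppose that $G$ is hyperbolic, that is, the Cayley graph of $G$ with respect to some finite generating set is Gromov hyperbolic. Then, for every $g\in G$, the limit $\tau_{\mathcal L}(g)=\lim_{n\to\infty}|g^n|_{\mathcal L}/n$ (the stable $\mathcal L$-word length of $g$) exists, and $$\lim_{n\to\infty}\frac{\|g^n\|_{\mathcal L}}{n}=\tau_{\mathcal L}(g).$$ -/

import Mathlib

open Filter Topology

/-- A connected graph is (Gromov) hyperbolic if its geodesic triangles are uniformly slim: for some
`δ`, every vertex on a side of a geodesic triangle is within distance `δ` of a vertex on one of the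
other two sides. -/
def SimpleGraph.IsGromovHyperbolic {V : Type*} (X : SimpleGraph V) : Prop :=
  X.Connected ∧ ∃ δ : ℕ, ∀ (x y z : V) (p : X.Walk x y) (q : X.Walk y z) (r : X.Walk x z),
    p.length = X.dist x y → q.length = X.dist y z → r.length = X.dist x z →
      ∀ u ∈ p.support, ∃ v, (v ∈ q.support ∨ v ∈ r.support) ∧ X.dist u v ≤ δ

/-- A group is hyperbolic if it has a finite generating set whose Cayley graph is hyperbolic. -/
def IsHyperbolicGroup (G : Type*) [Group G] : Prop :=
  ∃ S : Set G, S.Finite ∧ Subgroup.closure S = ⊤ ∧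
    (SimpleGraph.mulCayley S).IsGromovHyperbolic

namespace Biautomatic

variable {G A : Type*} [Group G]

/-- The element of `G` labelled by a word over the alphabet `A`, where the letters are mapped to `G`
by `π`. -/
def label (π : A → G) (w : List A) : G := (w.map π).prod

/-- The combinatorial distance `d_A` on the Cayley graph of `G` with respect to `π : A → G`. -/
noncomputable def cayDist (π : A → G) (g h : G) : ℕ :=
  (SimpleGraph.mulCayley (Set.range π)).dist g h

/-- The vertex at time `t` of the path in the Cayley graph that starts at `g` and is labelled by `w`;
from time `w.length` on it is the final vertex of the path. -/
def pathVertex (π : A → G) (g : G) (w : List A) (t : ℕ) : G := g * label π (w.take t)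

/-- `(A, L)`, with the finite alphabet `A` mapped to `G` by `π`, is a (uniformly finite-to-one)
biautomatic structure on `G`. -/
structure IsBiautomaticStructure [Finite A] (π : A → G) (L : Language A) : Prop where
  /-- `A` generates `G` as a monoid. -/
  surjective : Function.Surjective (label π)
  /-- `A` is symmetric. -/
  symm : ∀ a, ∃ b, π b = (π a)⁻¹
  /-- `A` contains the identity. -/
  one : ∃ a, π a = 1
  /-- `L` is recognised by a finite state automaton. -/
  regular : L.IsRegular
  /-- Every element of `G` has at least one and at most `N` representatives in `L`. -/
  finite_to_one : ∃ N : ℕ, 1 ≤ N ∧ ∀ g : G,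
    1 ≤ {w : List A | w ∈ L ∧ label π w = g}.encard ∧
      {w : List A | w ∈ L ∧ label π w = g}.encard ≤ N
  /-- The two-sided fellow traveller property: paths labelled by words in `L` that start at distance
  at most `1` and end at distance at most `1` from each other stay uniformly close. -/
  fellow_traveller : ∃ ζ : ℕ, 1 ≤ ζ ∧ ∀ v ∈ L, ∀ w ∈ L, ∀ g h : G,
    cayDist π g h ≤ 1 → cayDist π (g * label π v) (h * label π w) ≤ 1 →
      ∀ t : ℕ, cayDist π (pathVertex π g v t) (pathVertex π h w t) ≤ ζ

/-- The `L`-word length of `g`: the length of a shortest word in `L` representing `g`. -/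
noncomputable def wordLength (π : A → G) (L : Language A) (g : G) : ℕ :=
  sInf {n : ℕ | ∃ w ∈ L, label π w = g ∧ w.length = n}

/-- The conjugacy `L`-word length of `g`: the least `L`-word length of a conjugate of `g`. -/
noncomputable def conjWordLength (π : A → G) (L : Language A) (g : G) : ℕ :=
  ⨅ h : G, wordLength π L (h * g * h⁻¹)

/-- The stable `L`-word length of `g`: the limit of the `L`-word length of `g ^ n` divided by `n`.
(This is `limUnder`, so it is meaningful where the limit exists.) -/
noncomputable def stableWordLength (π : A → G) (L : Language A) (g : G) : ℝ :=
  limUnder atTop (fun n : ℕ => (wordLength π L (g ^ n) : ℝ) / n)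

end Biautomatic

/-! Write `lam` for the `L`-word length. Fellow travelling and regularity make `lam` Lipschitz under
multiplication on either side, and make a subword of a word of `L` about as long as the `lam` of its
label. Hence words of `L` label quasi-geodesics. In a hyperbolic group such a path from `1` to `x *
y` passes near `x` whenever the Gromov product of `1` and `x * y` at `x` is bounded; cutting it
there gives `lam x + lam y ≤ lam (x * y) + C` (`IsCombingLength.exists_add_le`).

Powers of a fixed `g` have bounded Gromov products (`exists_dist_pow_add_le`), so `lam (g ^ n)` is
superadditive up to a constant and Fekete's lemma yields the limit. For a conjugate of `g ^ n`,
multiply the conjugator by a power of `g` to get `x⁻¹ * g ^ n * x` with `1` a nearest power of `g`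
to `x`. If `g ^ n` is long, `x⁻¹`, `g ^ n`, `x` concatenate to a near-geodesic, so `lam (g ^ n)`
exceeds `lam` of the conjugate by at most a constant independent of `n` and `x`
(`exists_pow_le_conj`); division by `n` removes it. -/

/-! ### Four-point hyperbolicity and Gromov products -/

/-- An integer-valued distance function that is geodesic and satisfies Gromov's four-point
condition with constant `δ`. -/
structure IsHyperbolicDist {V : Type*} (d : V → V → ℤ) (δ : ℤ) : Prop where
  self : ∀ x, d x x = 0
  comm : ∀ x y, d x y = d y x
  tri : ∀ x y z, d x z ≤ d x y + d y z
  geod : ∀ x y k, 0 ≤ k → k ≤ d x y → ∃ z, d x z = k ∧ d z y = d x y - k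
  four : ∀ w x y z, d x z + d y w ≤ d x y + d z w + δ ∨ d x z + d y w ≤ d y z + d x w + δ

/-- Twice the Gromov product of `x` and `y` with respect to the base point `w`. -/
def gromovProd {V : Type*} (d : V → V → ℤ) (w x y : V) : ℤ := d w x + d w y - d x y

namespace IsHyperbolicDist

variable {V : Type*} {d : V → V → ℤ} {δ : ℤ}

theorem nonneg (H : IsHyperbolicDist d δ) (x y : V) : 0 ≤ d x y := by
  have h1 := H.tri x y x
  have h2 := H.comm x y
  have h3 := H.self x
  omega

theorem delta_nonneg (H : IsHyperbolicDist d δ) (x : V) : 0 ≤ δ := by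
  have h1 := H.four x x x x
  omega

theorem gromovProd_comm (H : IsHyperbolicDist d δ) (w x y : V) :
    gromovProd d w x y = gromovProd d w y x := by
  have := H.comm x y
  simp only [gromovProd]
  omega

theorem le_gromovProd_of_le (H : IsHyperbolicDist d δ) {m : ℤ} {w x y z : V}
    (h1 : m ≤ gromovProd d w x y) (h2 : m ≤ gromovProd d w y z) :
    m - δ ≤ gromovProd d w x z := by
  have h := H.four w x y z
  have e1 := H.comm w x
  have e2 := H.comm w y
  have e3 := H.comm w z
  simp only [gromovProd] at *
  omega

theorem gromovProd_le_two_mul (H : IsHyperbolicDist d δ) (w x y : V) :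
    gromovProd d w x y ≤ 2 * d w x := by
  have := H.tri w x y
  simp only [gromovProd]
  omega

/-- Halving the chain costs `δ` per level, so the loss is logarithmic in the number of points. -/
theorem le_gromovProd_chain (H : IsHyperbolicDist d δ) {m : ℤ} {w : V} (k : ℕ) :
    ∀ (x : ℕ → V) (N : ℕ), 1 ≤ N → N ≤ 2 ^ k →
      (∀ i < N, m ≤ gromovProd d w (x i) (x (i + 1))) →
      m - k * δ ≤ gromovProd d w (x 0) (x N) := by
  have hδ := H.delta_nonneg w
  induction k with
  | zero =>
    intro x N h1 h2 h
    obtain rfl : N = 1 := by simp at h2; omega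
    simpa using h 0 (by norm_num)
  | succ k ih =>
    intro x N h1 h2 h
    have e : ((k + 1 : ℕ) : ℤ) * δ = k * δ + δ := by push_cast; ring
    rw [e]
    by_cases hN : N ≤ 2 ^ k
    · have := ih x N h1 hN h
      linarith
    · rw [pow_succ] at h2
      have hp : 1 ≤ 2 ^ k := Nat.one_le_two_pow
      have a1 := ih x (2 ^ k) hp le_rfl (fun i hi => h i (by omega))
      have a2 := ih (fun i => x (2 ^ k + i)) (N - 2 ^ k) (by omega) (by omega)
        (fun i hi => h (2 ^ k + i) (by omega))
      simp only [Nat.add_zero] at a2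
      rw [show 2 ^ k + (N - 2 ^ k) = N by omega] at a2
      have := H.le_gromovProd_of_le a1 a2
      linarith

/-! ### Stability of quasi-geodesics -/

theorem exists_mul_le_two_pow (B : ℕ) : ∃ q₀ : ℕ, ∀ q ≥ q₀, B * (q + 1) ≤ 2 ^ q := by
  refine ⟨2 * B, fun q hq => ?_⟩
  induction q, hq using Nat.le_induction with
  | base =>
    induction B with
    | zero => simp
    | succ B ih =>
      rw [show 2 * (B + 1) = 2 * B + 2 by ring, pow_add]
      rcases Nat.lt_or_ge B 2 with h | h
      · interval_cases B <;> norm_num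
      · nlinarith
  | succ q hq ih =>
    rw [pow_succ]
    nlinarith

/-- Exponentials beat linear functions, in the form needed to bound the distance from a geodesic
to a quasi-geodesic. -/
theorem exists_two_pow_bound (c : ℕ) (δ : ℤ) (hδ : 0 ≤ δ) : ∃ R : ℤ, ∀ D : ℕ, R < D →
    ∃ k : ℕ, (6 * c * D + c : ℤ) ≤ 2 ^ k ∧ c + (k + 2) * δ < 2 * D := by
  lift δ to ℕ using hδ
  obtain ⟨q₀, hq₀⟩ := exists_mul_le_two_pow (6 * c * (δ + 1) + c)
  -- With `k = D / (δ + 1)`, `k * δ ≤ D` and `c + 2 * δ < D`, while `2 ^ k` is exponential in `D`.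
  refine ⟨(c + 2 * δ + (δ + 1) * q₀ : ℕ), fun D hD => ⟨D / (δ + 1), ?_, ?_⟩⟩
  · have hD' : (δ + 1) * q₀ ≤ D := by
      have : c + 2 * δ + (δ + 1) * q₀ < D := by exact_mod_cast hD
      omega
    have hq : q₀ ≤ D / (δ + 1) := (Nat.le_div_iff_mul_le (by omega)).2 (by linarith)
    have h1 := hq₀ _ hq
    have h2 : D < (δ + 1) * (D / (δ + 1) + 1) := Nat.lt_mul_div_succ D (by omega)
    have : 6 * c * D + c ≤ 2 ^ (D / (δ + 1)) := by
      refine le_trans ?_ h1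
      generalize D / (δ + 1) = q at *
      have : c * D ≤ c * ((δ + 1) * (q + 1)) := Nat.mul_le_mul_left _ h2.le
      have h3 : c ≤ c * (q + 1) := Nat.le_mul_of_pos_right _ (by omega)
      calc 6 * c * D + c = 6 * (c * D) + c := by ring
        _ ≤ 6 * (c * ((δ + 1) * (q + 1))) + c * (q + 1) := by omega
        _ = _ := by ring
    exact_mod_cast this
  · have h1 : D / (δ + 1) * (δ + 1) ≤ D := Nat.div_mul_le_self _ _
    have h2 : c + 2 * δ + (δ + 1) * q₀ < D := by exact_mod_cast hD
    have : c + (D / (δ + 1) + 2) * δ < 2 * D := by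
      generalize D / (δ + 1) = q at *
      nlinarith [Nat.zero_le ((δ + 1) * q₀)]
    exact_mod_cast this

/-- Used with `z` a point of a geodesic at maximal distance `D` from the path: `y` lies `2 * D` back
towards the endpoint `p e`, or is `p e` itself if that is closer, and `p s` is a path point within
`D` of `y`. -/
theorem exists_far_between (H : IsHyperbolicDist d δ) {n : ℕ} {p : ℕ → V} {z : V} {D : ℕ}
    (hz : ∀ t ≤ n, (D : ℤ) ≤ d z (p t)) {e : ℕ} (he : e ≤ n)
    (hmax : ∀ y, d (p e) y + d y z = d (p e) z → ∃ t ≤ n, d y (p t) ≤ D) :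
    ∃ y, ∃ s ≤ n, d (p e) y + d y z = d (p e) z ∧ (2 * D : ℤ) ≤ gromovProd d z y (p s) ∧
      d z (p s) ≤ 3 * D := by
  have c1 := H.comm (p e) z
  have h0 := hz e he
  by_cases h : d (p e) z ≤ 2 * D
  · have := H.self (p e)
    refine ⟨p e, e, he, by omega, ?_, by omega⟩
    simp only [gromovProd]
    omega
  · obtain ⟨y, hy1, hy2⟩ := H.geod (p e) z (d (p e) z - 2 * D) (by omega) (by omega)
    obtain ⟨s, hs, hs'⟩ := hmax y (by omega)
    have h1 := hz s hs
    have h2 := H.comm y z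
    have h3 := H.tri z y (p s)
    refine ⟨y, s, hs, by omega, ?_, by omega⟩
    simp only [gromovProd]
    omega

/-- The two points are within `6 * D` of each other, so the path between them has at most `2 ^ k`
steps. Each step has length at most `c` and stays `D` away from `z`, so `le_gromovProd_chain`
applies with `m = 2 * D - c`. -/
theorem le_gromovProd_path (H : IsHyperbolicDist d δ) {c n : ℕ} {p : ℕ → V}
    (hc : ∀ t, d (p t) (p (t + 1)) ≤ c)
    (hq : ∀ s t, s ≤ t → t ≤ n → (t : ℤ) - s ≤ c * d (p s) (p t) + c) {z : V} {D k : ℕ}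
    (hz : ∀ t ≤ n, (D : ℤ) ≤ d z (p t)) (hk : (6 * c * D + c : ℤ) ≤ 2 ^ k) {s t : ℕ}
    (hst : s ≤ t) (ht : t ≤ n) (hs' : d z (p s) ≤ 3 * D) (ht' : d z (p t) ≤ 3 * D) :
    (2 * D - c : ℤ) - k * δ ≤ gromovProd d z (p s) (p t) := by
  have hδ := H.delta_nonneg z
  rcases hst.eq_or_lt with rfl | hlt
  · have := hz s ht
    have h2 : 0 ≤ k * δ := by positivity
    simp only [gromovProd, H.self]
    omega
  · have hd : d (p s) (p t) ≤ 6 * D := by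
      have h1 := H.tri (p s) z (p t)
      have h2 := H.comm z (p s)
      omega
    have hts : (t : ℤ) - s ≤ 2 ^ k := by
      have h1 := hq s t hst ht
      have h2 : (c : ℤ) * d (p s) (p t) ≤ c * (6 * D) := by gcongr
      linarith
    have h := H.le_gromovProd_chain (m := 2 * D - c) (w := z) k (fun i => p (s + i)) (t - s)
      (by omega) (by zify [hst]; exact hts) (fun i hi => by
        have h1 := hz (s + i) (by omega)
        have h2 := hz (s + (i + 1)) (by omega)
        have h3 := hc (s + i)
        simp only [gromovProd]
        rw [← Nat.add_assoc] at *
        omega)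
    simpa [hst] using h

/-- Geodesics stay uniformly close to quasi-geodesic paths with the same endpoints. -/
theorem exists_near_of_between (H : IsHyperbolicDist d δ) (c : ℕ) :
    ∃ R : ℤ, ∀ (n : ℕ) (p : ℕ → V), (∀ t, d (p t) (p (t + 1)) ≤ c) →
      (∀ s t, s ≤ t → t ≤ n → (t : ℤ) - s ≤ c * d (p s) (p t) + c) →
      ∀ z, d (p 0) z + d z (p n) = d (p 0) (p n) → ∃ t ≤ n, d z (p t) ≤ R := by
  rcases isEmpty_or_nonempty V with hV | ⟨⟨v⟩⟩
  · exact ⟨0, fun n p => hV.elim (p 0)⟩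
  obtain ⟨R, hR⟩ := exists_two_pow_bound c δ (H.delta_nonneg v)
  refine ⟨R, fun n p hc hq z₀ hz₀ => ?_⟩
  by_contra! hcon
  let T : Set ℕ := {D | ∃ z, d (p 0) z + d z (p n) = d (p 0) (p n) ∧
    ∀ t ≤ n, (D : ℤ) ≤ d z (p t)}
  have hbdd : BddAbove T := by
    refine ⟨(d (p 0) (p n)).toNat, ?_⟩
    rintro D ⟨z, hz, h⟩
    have h1 := h 0 (Nat.zero_le _)
    have h2 := H.comm z (p 0)
    have h3 := H.nonneg z (p n)
    omega
  have hzero : 0 ∈ T := ⟨z₀, hz₀, fun t _ => by simpa using H.nonneg _ _⟩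
  -- `D` is the largest distance from a point of the geodesic to the path.
  set D := sSup T with hD
  obtain ⟨z, hz, hzD⟩ : D ∈ T := Nat.sSup_mem ⟨0, hzero⟩ hbdd
  have hmax : ∀ y, d (p 0) y + d y (p n) = d (p 0) (p n) → ∃ t ≤ n, d y (p t) ≤ D := by
    intro y hy
    by_contra! hh
    have : D + 1 ∈ T := ⟨y, hy, fun t ht => by have := hh t ht; push_cast; omega⟩
    have := le_csSup hbdd this
    omega
  have hRD : R < D := by
    by_cases hR0 : R < 0
    · omega
    have : (R + 1).toNat ∈ T := ⟨z₀, hz₀, fun t ht => by have := hcon t ht; omega⟩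
    have := le_csSup hbdd this
    omega
  obtain ⟨k, hk1, hk2⟩ := hR D hRD
  obtain ⟨y, s, hs, hy1, hy2, hy3⟩ := H.exists_far_between hzD (Nat.zero_le n) (fun y hy => by
    refine hmax y ?_
    have h1 := H.tri y z (p n)
    have h2 := H.tri (p 0) y (p n)
    omega)
  obtain ⟨y', s', hs', hy1', hy2', hy3'⟩ := H.exists_far_between hzD le_rfl (fun y hy => by
    refine hmax y ?_
    have h1 := H.tri (p 0) z y
    have h2 := H.tri (p 0) y (p n)
    have h3 := H.comm (p n) y
    have h4 := H.comm (p n) z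
    have h5 := H.comm y z
    omega)
  have hmid : (2 * D - c : ℤ) - k * δ ≤ gromovProd d z (p s) (p s') := by
    rcases le_total s s' with h | h
    · exact H.le_gromovProd_path hc hq hzD hk1 h hs' hy3 hy3'
    · rw [H.gromovProd_comm]
      exact H.le_gromovProd_path hc hq hzD hk1 h hs hy3' hy3
  have hδ := H.delta_nonneg v
  have hkδ : 0 ≤ k * δ := by positivity
  have g1 := H.le_gromovProd_of_le (m := (2 * D - c : ℤ) - k * δ) (by linarith) hmid
  have g2 := H.le_gromovProd_of_le (m := (2 * D - c : ℤ) - k * δ - δ) (z := y') g1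
    (by rw [H.gromovProd_comm]; linarith)
  -- `y` and `y'` lie on opposite sides of `z` on a geodesic, whereas the chain `y`, `p s`, `p s'`,
  -- `y'` forces a positive product.
  have hyy : gromovProd d z y y' ≤ 0 := by
    have h1 := H.tri (p 0) y (p n)
    have h2 := H.tri y y' (p n)
    have h3 := H.comm (p n) y'
    have h4 := H.comm (p n) z
    have h5 := H.comm y z
    have h6 := H.comm y' z
    simp only [gromovProd]
    omega
  linarith

/-- Points at which the endpoints of a quasi-geodesic path have a bounded Gromov product are
uniformly close to the path. -/
theorem exists_near_of_gromovProd_le (H : IsHyperbolicDist d δ) (c : ℕ) (K : ℤ) :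
    ∃ R : ℕ, ∀ (n : ℕ) (p : ℕ → V), (∀ t, d (p t) (p (t + 1)) ≤ c) →
      (∀ s t, s ≤ t → t ≤ n → (t : ℤ) - s ≤ c * d (p s) (p t) + c) →
      ∀ x, gromovProd d x (p 0) (p n) ≤ K → ∃ t ≤ n, d x (p t) ≤ R := by
  obtain ⟨R, hR⟩ := H.exists_near_of_between c
  refine ⟨(R + K + 2 * δ + 2).toNat, fun n p hc hq x hx => ?_⟩
  simp only [gromovProd] at hx
  have e1 := H.comm x (p 0)
  have t0 := H.tri (p 0) (p n) x
  have t0' := H.comm (p n) x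
  have t1 := H.tri (p 0) x (p n)
  have t2 := H.tri x (p 0) (p n)
  -- `q` is the point of a geodesic where the triangle with apex `x` branches; its distance to `x`
  -- is about the Gromov product at `x`.
  obtain ⟨q, hq1, hq2⟩ := H.geod (p 0) (p n) ((d (p 0) x + d (p 0) (p n) - d x (p n)) / 2)
    (by omega) (by omega)
  obtain ⟨t, ht, ht'⟩ := hR n p hc hq q (by omega)
  refine ⟨t, ht, ?_⟩
  have h4 := H.four q (p 0) x (p n)
  have h5 := H.tri x q (p t)
  have e2 := H.comm (p n) q
  have hδ := H.delta_nonneg x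
  omega

end IsHyperbolicDist

/-! ### Powers of an element in a hyperbolic group -/

namespace IsHyperbolicDist

variable {G : Type*} [Group G] {d : G → G → ℤ} {δ : ℤ}

theorem dist_one_inv (H : IsHyperbolicDist d δ) (inv : ∀ g x y, d (g * x) (g * y) = d x y)
    (g : G) : d 1 g⁻¹ = d 1 g := by
  have := inv g 1 g⁻¹
  rw [mul_one, mul_inv_cancel] at this
  rw [← this, H.comm]

theorem dist_one_mul_le (H : IsHyperbolicDist d δ) (inv : ∀ g x y, d (g * x) (g * y) = d x y)
    (x y : G) : d 1 (x * y) ≤ d 1 x + d 1 y := by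
  have h1 := H.tri 1 x (x * y)
  have h2 := inv x 1 y
  rw [mul_one] at h2
  omega

theorem dist_one_pow_le (H : IsHyperbolicDist d δ) (inv : ∀ g x y, d (g * x) (g * y) = d x y)
    (g : G) (n : ℕ) : d 1 (g ^ n) ≤ n * d 1 g := by
  induction n with
  | zero => simp [H.self]
  | succ n ih =>
    rw [pow_succ]
    have := H.dist_one_mul_le inv (g ^ n) g
    push_cast
    linarith

theorem orbit_dist (inv : ∀ g x y, d (g * x) (g * y) = d x y) (f m : G) (i j : ℕ) :
    d (f ^ i * m) (f ^ (i + j) * m) = d m (f ^ j * m) := by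
  rw [pow_add, mul_assoc, inv]

/-- Local-to-global principle: a bounded product at each orbit point and steps longer than `a + δ`
rule out one alternative of the four-point condition; the other is the induction step. -/
theorem orbit_succ (H : IsHyperbolicDist d δ) (inv : ∀ g x y, d (g * x) (g * y) = d x y)
    {f m : G} {a : ℤ} (ha : 2 * d m (f * m) - a ≤ d m (f ^ 2 * m))
    (hρ : a + δ < d m (f * m)) (n : ℕ) :
    d m (f ^ n * m) + d m (f * m) ≤ d m (f ^ (n + 1) * m) + a + δ := by
  have hδ := H.delta_nonneg m
  induction n with
  | zero =>
    have h1 := H.tri m (f * m) (f ^ 2 * m)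
    have h2 := orbit_dist inv f m 1 1
    simp only [pow_one, Nat.reduceAdd] at h2
    simp only [pow_zero, one_mul, H.self, zero_add, pow_one]
    omega
  | succ n ih =>
    have h4 := H.four (f ^ (n + 1) * m) (f ^ n * m) m (f ^ (n + 2) * m)
    have e1 := orbit_dist inv f m n 2
    have e2 := orbit_dist inv f m n 1
    have e3 := orbit_dist inv f m (n + 1) 1
    have e4 := H.comm (f ^ n * m) m
    have e5 := H.comm (f ^ (n + 2) * m) (f ^ (n + 1) * m)
    simp only [pow_one] at e2 e3
    rw [show n + 1 + 1 = n + 2 by rfl] at *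
    omega

theorem orbit_add (H : IsHyperbolicDist d δ) (inv : ∀ g x y, d (g * x) (g * y) = d x y)
    {f m : G} {a : ℤ} (ha : 2 * d m (f * m) - a ≤ d m (f ^ 2 * m))
    (hρ : a + 2 * δ < d m (f * m)) (n k : ℕ) :
    d m (f ^ n * m) + d m (f ^ k * m) ≤ d m (f ^ (n + k) * m) + a + 2 * δ := by
  have hδ := H.delta_nonneg m
  have s := H.orbit_succ inv ha (by omega)
  cases k with
  | zero =>
    have := s 0
    simp only [pow_zero, one_mul, H.self, zero_add, pow_one] at this
    simp only [pow_zero, one_mul, H.self, add_zero]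
    omega
  | succ k =>
    have h4 := H.four (f ^ n * m) m (f ^ (n + (k + 1)) * m) (f ^ (n + 1) * m)
    have e1 := orbit_dist inv f m n (k + 1)
    have e2 := orbit_dist inv f m n 1
    have e3 := orbit_dist inv f m (n + 1) k
    rw [show n + 1 + k = n + (k + 1) by ring] at e3
    have e4 := H.comm (f ^ n * m) m
    have e5 := H.comm (f ^ (n + (k + 1)) * m) (f ^ n * m)
    have e6 := H.comm (f ^ (n + (k + 1)) * m) (f ^ (n + 1) * m)
    have e7 := H.comm (f ^ (n + 1) * m) (f ^ n * m)
    have s1 := s n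
    have s2 := s k
    simp only [pow_one] at e2
    omega

/-- If `f` commutes with `X` and `m` is a point of a geodesic from `1` to `X` that is far from both
endpoints, and `f` moves `m` far enough, then `f` translates `m` along the geodesic. -/
theorem two_mul_dist_le_of_between (H : IsHyperbolicDist d δ)
    (inv : ∀ g x y, d (g * x) (g * y) = d x y) {f m X : G} (hf : f * X = X * f) {E : ℤ}
    (hE : d 1 f ≤ E) (hX : d 1 m + d m X = d 1 X) (h1 : 4 * E + 10 * δ + 1 < d 1 m)
    (h2 : 4 * E + 10 * δ + 1 < d m X) (hρ : 3 * δ < d m (f * m)) :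
    2 * d m (f * m) - 7 * δ ≤ d m (f ^ 2 * m) := by
  have hδ := H.delta_nonneg m
  have hE0 := H.nonneg 1 f
  have eX : d X (f * X) = d 1 f := by
    have := inv X 1 f
    rwa [mul_one, ← hf] at this
  have i0 : d f (f * m) = d 1 m := by simpa using inv f 1 m
  have i1 : d (f * m) (f * X) = d m X := inv f m X
  have i2 : d f (f * X) = d 1 X := by simpa using inv f 1 X
  have i3 : d f (f ^ 2 * m) = d 1 (f * m) := by simpa [pow_two, mul_assoc] using inv f 1 (f * m)
  have i4 : d (f * m) (f ^ 2 * m) = d m (f * m) := by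
    simpa [pow_two, mul_assoc] using inv f m (f * m)
  have c1 := H.comm (f * m) f
  have c2 := H.comm (f * m) 1
  have c3 := H.comm f 1
  have c4 := H.comm (f * m) X
  have c5 := H.comm m 1
  have c6 := H.comm m (f * m)
  have c7 := H.comm m X
  have t1 := H.tri f 1 (f * m)
  have t2 := H.tri 1 f (f * m)
  have t3 := H.tri (f * m) X (f * X)
  -- `f * m` is on a geodesic from `f` to `f * X`, whose ends are within `E` of `1` and `X`. Being
  -- far from both ends, it is also close to a geodesic from `1` to `X`.
  have hgp : gromovProd d (f * m) 1 X ≤ 2 * δ := by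
    by_contra! hlt
    have g1 : 2 * δ + 1 ≤ gromovProd d (f * m) f 1 := by simp only [gromovProd]; omega
    have g2 : 2 * δ + 1 ≤ gromovProd d (f * m) X (f * X) := by simp only [gromovProd]; omega
    have g3 := H.le_gromovProd_of_le g1 (Int.add_one_le_of_lt hlt)
    have g4 := H.le_gromovProd_of_le (m := 2 * δ + 1 - δ) (z := f * X) g3 (by omega)
    simp only [gromovProd] at g4
    omega
  simp only [gromovProd] at hgp
  -- `q1` says that `f * m` lies ahead of `m` or behind it by the full displacement, up to `3 * δ`.
  -- Then `q2` (ahead) or `q3` (behind) shows that the distance from `1` changes twice as much at `f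
  -- ^ 2 * m`, up to `δ`: in total `2 * 3 * δ + δ = 7 * δ`.
  have q1 := H.four (f * m) 1 m X
  have q2 := H.four (f ^ 2 * m) 1 f (f * m)
  have q3 := H.four (f * m) 1 f (f ^ 2 * m)
  have c8 := H.comm (f ^ 2 * m) f
  have c9 := H.comm (f ^ 2 * m) 1
  have c10 := H.comm (f ^ 2 * m) (f * m)
  have t4 := H.tri 1 m (f ^ 2 * m)
  have t5 := H.tri 1 (f ^ 2 * m) m
  have c11 := H.comm (f ^ 2 * m) m
  have t6 := H.tri f 1 (f ^ 2 * m)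
  omega

theorem exists_pow_translating (H : IsHyperbolicDist d δ)
    (inv : ∀ g x y, d (g * x) (g * y) = d x y) (fin : ∀ R : ℤ, {g | d 1 g ≤ R}.Finite)
    {g : G} (hg : ¬ IsOfFinOrder g) (R : ℤ) (hR : 3 * δ ≤ R) :
    ∃ i > 0, ∃ m, R < d m (g ^ i * m) ∧
      2 * d m (g ^ i * m) - 7 * δ ≤ d m ((g ^ i) ^ 2 * m) := by
  have hinj : Function.Injective fun n : ℕ => g ^ n := injective_pow_iff_not_isOfFinOrder.2 hg
  have hδ := H.delta_nonneg 1
  have hg0 := H.nonneg 1 g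
  -- `M` depends on `R` only, so `E` bounds the displacement of `1` by all candidate powers before
  -- `n` and the midpoint `m` are chosen.
  set M := (fin R).toFinset.card with hM
  set E : ℤ := M * d 1 g with hE
  have hE0 : 0 ≤ E := by positivity
  obtain ⟨n, hn⟩ : ∃ n : ℕ, 8 * E + 20 * δ + 6 < d 1 (g ^ n) := by
    by_contra! hcon
    exact Set.infinite_range_of_injective hinj
      ((fin (8 * E + 20 * δ + 6)).subset (by rintro _ ⟨n, rfl⟩; exact hcon n))
  obtain ⟨m, hm1, hm2⟩ := H.geod 1 (g ^ n) (d 1 (g ^ n) / 2) (by omega) (by omega)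
  -- Pigeonhole: the `M + 1` distinct conjugates `m⁻¹ * g ^ i * m` with `i ≤ M` cannot all lie in a
  -- ball of `M` elements.
  obtain ⟨i, hi0, hiM, hi⟩ : ∃ i, 0 < i ∧ i ≤ M ∧ R < d m (g ^ i * m) := by
    by_contra! hcon
    obtain ⟨i, -, j, -, hij, h⟩ := Finset.exists_ne_map_eq_of_card_lt_of_maps_to
      (s := Finset.range (M + 1)) (t := (fin R).toFinset) (f := fun i => m⁻¹ * (g ^ i * m))
      (by rw [Finset.card_range]; omega) (by
        intro i hi
        have hi' : i ≤ M := by simpa [Nat.lt_succ_iff] using hi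
        have e : d 1 (m⁻¹ * (g ^ i * m)) = d m (g ^ i * m) := by
          have := inv m 1 (m⁻¹ * (g ^ i * m))
          rwa [mul_one, mul_inv_cancel_left, eq_comm] at this
        simp only [Set.Finite.coe_toFinset, Set.mem_ofPred_eq, e]
        rcases Nat.eq_zero_or_pos i with rfl | h0
        · simp only [pow_zero, one_mul, H.self]; omega
        · exact hcon i h0 hi')
    exact hij (hinj (by simpa using h))
  refine ⟨i, hi0, m, hi, H.two_mul_dist_le_of_between inv (X := g ^ n) (E := E)
    (by rw [← pow_add, ← pow_add, Nat.add_comm]) ?_ (by omega) (by omega) (by omega) (by omega)⟩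
  refine (H.dist_one_pow_le inv g i).trans ?_
  rw [hE]
  gcongr

theorem abs_dist_pow_sub_le (H : IsHyperbolicDist d δ)
    (inv : ∀ g x y, d (g * x) (g * y) = d x y) (g m : G) {i : ℕ} (hi : 0 < i) (n : ℕ) :
    d 1 (g ^ n) ≤ d m ((g ^ i) ^ (n / i) * m) + (2 * d 1 m + i * d 1 g) ∧
      d m ((g ^ i) ^ (n / i) * m) ≤ d 1 (g ^ n) + (2 * d 1 m + i * d 1 g) := by
  set F := (g ^ i) ^ (n / i) with hF
  have hn : g ^ n = F * g ^ (n % i) := by rw [hF, ← pow_mul, ← pow_add, Nat.div_add_mod]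
  have h1 : d F (g ^ n) ≤ i * d 1 g := by
    have e := inv F 1 (g ^ (n % i))
    rw [mul_one, ← hn] at e
    rw [e]
    refine (H.dist_one_pow_le inv g _).trans ?_
    have := H.nonneg 1 g
    have := (Nat.mod_lt n hi).le
    gcongr
  have h2 : d F (F * m) = d 1 m := by simpa using inv F 1 m
  have t1 := H.tri 1 F (g ^ n)
  have t2 := H.tri 1 m F
  have t3 := H.tri m (F * m) F
  have t4 := H.tri m F (F * m)
  have t5 := H.tri m 1 F
  have t6 := H.tri 1 (g ^ n) F
  have c1 := H.comm F (g ^ n)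
  have c2 := H.comm m 1
  have c3 := H.comm F (F * m)
  omega

/-- The orbit of a cyclic subgroup has bounded Gromov products: the distance from `1` to the
`n`-th power is superadditive up to a bounded error. -/
theorem exists_dist_pow_add_le (H : IsHyperbolicDist d δ)
    (inv : ∀ g x y, d (g * x) (g * y) = d x y) (fin : ∀ R : ℤ, {g | d 1 g ≤ R}.Finite) (g : G) :
    ∃ K : ℤ, ∀ n k : ℕ, d 1 (g ^ n) + d 1 (g ^ k) ≤ d 1 (g ^ (n + k)) + K := by
  by_cases hg : IsOfFinOrder g
  · have hb : ∀ n, d 1 (g ^ n) ≤ orderOf g * d 1 g := by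
      intro n
      rw [← pow_mod_orderOf]
      refine (H.dist_one_pow_le inv g _).trans ?_
      have := H.nonneg 1 g
      have := (Nat.mod_lt n hg.orderOf_pos).le
      gcongr
    refine ⟨2 * (orderOf g * d 1 g), fun n k => ?_⟩
    have h1 := hb n
    have h2 := hb k
    have h3 := H.nonneg 1 (g ^ (n + k))
    linarith
  · have hδ := H.delta_nonneg 1
    obtain ⟨i, hi, m, hm, hm2⟩ := H.exists_pow_translating inv fin hg (10 * δ) (by omega)
    refine ⟨3 * (2 * d 1 m + i * d 1 g) + 9 * δ, fun n k => ?_⟩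
    have hn := H.abs_dist_pow_sub_le inv g m hi n
    have hk := H.abs_dist_pow_sub_le inv g m hi k
    have hnk := H.abs_dist_pow_sub_le inv g m hi (n + k)
    have hadd := H.orbit_add inv hm2 (by omega) (n / i) (k / i)
    -- `(n + k) / i` may exceed `n / i + k / i` by one; `orbit_succ` shows that the extra step does
    -- not decrease the distance.
    have hmono : d m ((g ^ i) ^ (n / i + k / i) * m) ≤ d m ((g ^ i) ^ ((n + k) / i) * m) := by
      rw [Nat.add_div hi]
      split_ifs
      · have := H.orbit_succ inv hm2 (by omega) (n / i + k / i)
        omega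
      · exact le_rfl
    omega

/-- If the product `r` were large, the first power `g ^ l` at distance at least `r / 2` from `1`
would lie near the common part of geodesics from `1` to `h` and to `g ^ n`, hence closer to `h` than
`1` is. -/
theorem gromovProd_le_of_nearest (H : IsHyperbolicDist d δ)
    (inv : ∀ g x y, d (g * x) (g * y) = d x y) {g h : G} {K : ℤ}
    (hK : ∀ n k : ℕ, d 1 (g ^ n) + d 1 (g ^ k) ≤ d 1 (g ^ (n + k)) + K)
    (hh : ∀ l : ℕ, d h 1 ≤ d h (g ^ l)) (n : ℕ) :
    gromovProd d 1 h (g ^ n) ≤ 2 * d 1 g + 2 * K + 2 * δ := by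
  classical
  set r := gromovProd d 1 h (g ^ n) with hr
  have hδ := H.delta_nonneg 1
  have h0 := H.nonneg 1 g
  have hK0 : 0 ≤ K := by
    have := hK 0 0
    simp only [pow_zero, H.self, Nat.add_zero] at this
    omega
  have hrn : r ≤ 2 * d 1 (g ^ n) := by
    rw [hr, H.gromovProd_comm]
    exact H.gromovProd_le_two_mul _ _ _
  have hex : ∃ l, r ≤ 2 * d 1 (g ^ l) := ⟨n, hrn⟩
  set l := Nat.find hex with hl
  have hl1 : r ≤ 2 * d 1 (g ^ l) := Nat.find_spec hex
  have hln : l ≤ n := Nat.find_min' hex hrn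
  rcases Nat.eq_zero_or_pos l with h | hpos
  · rw [h, pow_zero, H.self] at hl1
    omega
  · have hl2 : ¬ r ≤ 2 * d 1 (g ^ (l - 1)) := Nat.find_min hex (by omega)
    have hl3 : d 1 (g ^ l) ≤ d 1 (g ^ (l - 1)) + d 1 g := by
      have := H.dist_one_mul_le inv (g ^ (l - 1)) g
      rwa [← pow_succ, Nat.sub_add_cancel hpos] at this
    have hgp : r - K ≤ gromovProd d 1 (g ^ n) (g ^ l) := by
      have e1 := hK l (n - l)
      rw [Nat.add_sub_cancel' hln] at e1
      have e2 : d (g ^ l) (g ^ n) = d 1 (g ^ (n - l)) := by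
        have := inv (g ^ l) 1 (g ^ (n - l))
        rwa [mul_one, ← pow_add, Nat.add_sub_cancel' hln] at this
      have e3 := H.comm (g ^ l) (g ^ n)
      simp only [gromovProd]
      omega
    have hgp2 := H.le_gromovProd_of_le (m := r - K) (w := 1) (x := h) (by omega) hgp
    have h1 := hh l
    have h2 := H.comm h 1
    simp only [gromovProd] at hgp2
    omega

end IsHyperbolicDist

/-! ### Combing lengths: superadditivity and conjugation -/

/-- A length function `lam` on a group with a distance `d` that is Lipschitz under multiplication
on both sides and is realised, up to the additive error `c`, along a path from `1` to each
element. -/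
structure IsCombingLength {G : Type*} [Group G] (d : G → G → ℤ) (lam : G → ℕ) (c : ℕ) : Prop where
  lip_right : ∀ x e, (lam (x * e) : ℤ) ≤ lam x + c * d 1 e
  lip_left : ∀ x e, (lam (e * x) : ℤ) ≤ lam x + c * d 1 e
  path : ∀ x, ∃ (n : ℕ) (p : ℕ → G), p 0 = 1 ∧ p n = x ∧ (∀ t, d (p t) (p (t + 1)) ≤ c) ∧
    ∀ s t, s ≤ t → t ≤ n → (t : ℤ) - s ≤ lam ((p s)⁻¹ * p t) + c ∧
      (lam ((p s)⁻¹ * p t) : ℤ) ≤ t - s + c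

namespace IsCombingLength

variable {G : Type*} [Group G] {d : G → G → ℤ} {δ : ℤ} {lam : G → ℕ} {c : ℕ}

/-- The combing path to `x * y` is a quasi-geodesic passing within `R` of `x`. Its two pieces there
have lengths about `lam x` and `lam y`, by the Lipschitz bounds. -/
theorem exists_add_le (hlam : IsCombingLength d lam c) (H : IsHyperbolicDist d δ)
    (inv : ∀ g x y, d (g * x) (g * y) = d x y) (K : ℤ) :
    ∃ C : ℕ, ∀ x y, d 1 x + d 1 y ≤ d 1 (x * y) + K → lam x + lam y ≤ lam (x * y) + C := by
  obtain ⟨R, hR⟩ := H.exists_near_of_gromovProd_le (c + lam 1) K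
  refine ⟨3 * c + 2 * (c * R), fun x y hxy => ?_⟩
  obtain ⟨n, p, hp0, hpn, hpc, hp⟩ := hlam.path (x * y)
  have hd : ∀ u v, d 1 (u⁻¹ * v) = d u v := fun u v => by
    have := inv u 1 (u⁻¹ * v)
    rwa [mul_one, mul_inv_cancel_left, eq_comm] at this
  obtain ⟨t, ht, hxt⟩ := hR n p (fun t => (hpc t).trans (by push_cast; omega)) (by
    intro s t hst htn
    have h1 := (hp s t hst htn).1
    have h2 := hlam.lip_right 1 ((p s)⁻¹ * p t)
    rw [one_mul, hd] at h2
    have h3 : 0 ≤ (lam 1 : ℤ) * d (p s) (p t) := mul_nonneg (by positivity) (H.nonneg _ _)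
    push_cast
    linarith) x (by
    have e := hd x (x * y)
    rw [inv_mul_cancel_left] at e
    have e' := H.comm x 1
    rw [hp0, hpn]
    simp only [gromovProd]
    omega)
  have hcR : (c : ℤ) * d x (p t) ≤ c * R := by gcongr
  have b1 := (hp 0 t (Nat.zero_le _) ht).2
  have b2 := (hp t n ht le_rfl).2
  have b3 := (hp 0 n (Nat.zero_le _) le_rfl).1
  rw [hp0, inv_one, one_mul] at b1 b3
  rw [hpn] at b2 b3
  have a1 := hlam.lip_right (p t) ((p t)⁻¹ * x)
  rw [mul_inv_cancel_left, hd, H.comm] at a1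
  have a2 := hlam.lip_left ((p t)⁻¹ * (x * y)) (x⁻¹ * p t)
  rw [hd, show x⁻¹ * p t * ((p t)⁻¹ * (x * y)) = y by group] at a2
  zify
  push_cast at b1 b3
  linarith

/-- The length of the powers of an element is superadditive up to a bounded error. -/
theorem exists_pow_add_le (hlam : IsCombingLength d lam c) (H : IsHyperbolicDist d δ)
    (inv : ∀ g x y, d (g * x) (g * y) = d x y) (fin : ∀ R : ℤ, {g | d 1 g ≤ R}.Finite) (g : G) :
    ∃ C : ℕ, ∀ n k : ℕ, lam (g ^ n) + lam (g ^ k) ≤ lam (g ^ (n + k)) + C := by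
  obtain ⟨K, hK⟩ := H.exists_dist_pow_add_le inv fin g
  obtain ⟨C, hC⟩ := hlam.exists_add_le H inv K
  refine ⟨C, fun n k => ?_⟩
  rw [pow_add]
  exact hC _ _ (by rw [← pow_add]; exact hK n k)

/-- Conjugation shortens the powers of an element by a bounded amount only. -/
theorem exists_pow_le_conj (hlam : IsCombingLength d lam c) (H : IsHyperbolicDist d δ)
    (inv : ∀ g x y, d (g * x) (g * y) = d x y) (fin : ∀ R : ℤ, {g | d 1 g ≤ R}.Finite) (g : G) :
    ∃ C : ℕ, ∀ (n : ℕ) (h : G), lam (g ^ n) ≤ lam (h * g ^ n * h⁻¹) + C := by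
  obtain ⟨K, hK⟩ := H.exists_dist_pow_add_le inv fin g
  have hK' : ∀ n k : ℕ, d 1 (g⁻¹ ^ n) + d 1 (g⁻¹ ^ k) ≤ d 1 (g⁻¹ ^ (n + k)) + K := by
    intro n k
    simpa only [inv_pow, H.dist_one_inv inv] using hK n k
  have hδ := H.delta_nonneg 1
  set K' : ℤ := 2 * d 1 g + 2 * K + 2 * δ with hKdef
  obtain ⟨C, hC⟩ := hlam.exists_add_le H inv (K' + δ)
  refine ⟨2 * C + lam 1 + c * (K' + δ).toNat, fun n h => ?_⟩
  -- `x = g ^ (-k) * h⁻¹`, where `g ^ k` is a power of `g` nearest to `h⁻¹`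
  obtain ⟨x, hx, hnear⟩ : ∃ x, h * g ^ n * h⁻¹ = x⁻¹ * g ^ n * x ∧
      ∀ l : ℤ, d x 1 ≤ d x (g ^ l) := by
    obtain ⟨k, hk⟩ : ∃ k : ℤ, ∀ l : ℤ, d h⁻¹ (g ^ k) ≤ d h⁻¹ (g ^ l) := by
      obtain ⟨k, -, hk⟩ := (InvImage.wf (fun k : ℤ => (d h⁻¹ (g ^ k)).toNat)
        Nat.lt_wfRel.wf).has_min Set.univ ⟨0, trivial⟩
      refine ⟨k, fun l => ?_⟩
      have h1 := hk l trivial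
      have h2 := H.nonneg h⁻¹ (g ^ k)
      have h3 := H.nonneg h⁻¹ (g ^ l)
      simp only [InvImage] at h1
      change ¬ (_ < _) at h1
      omega
    refine ⟨g ^ (-k) * h⁻¹, ?_, fun l => ?_⟩
    · have : g ^ k * g ^ n * g ^ (-k) = g ^ n := by
        rw [← zpow_natCast, ← zpow_add, ← zpow_add]; congr 1; omega
      rw [mul_inv_rev, inv_inv, ← zpow_neg, neg_neg]
      calc h * g ^ n * h⁻¹ = h * (g ^ k * g ^ n * g ^ (-k)) * h⁻¹ := by rw [this]
        _ = _ := by group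
    · have e1 := inv (g ^ k) (g ^ (-k) * h⁻¹) 1
      have e2 := inv (g ^ k) (g ^ (-k) * h⁻¹) (g ^ l)
      rw [← mul_assoc, ← zpow_add, add_neg_cancel, zpow_zero, one_mul] at e1 e2
      rw [mul_one] at e1
      rw [← zpow_add] at e2
      rw [← e1, ← e2]
      exact hk _
  rw [hx]
  have g1 : gromovProd d 1 x (g ^ n) ≤ K' :=
    H.gromovProd_le_of_nearest inv hK (fun l => by simpa using hnear l) n
  have g2 : gromovProd d 1 x (g⁻¹ ^ n) ≤ K' := by
    have := H.gromovProd_le_of_nearest inv hK' (fun l => by simpa using hnear (-l)) n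
    rwa [H.dist_one_inv inv] at this
  have e1 : d (g ^ n) (g ^ n * x) = d 1 x := by simpa using inv (g ^ n) 1 x
  have e2 : d x (g⁻¹ ^ n) = d 1 (g ^ n * x) := by
    have := inv (g ^ n) x (g⁻¹ ^ n)
    rw [inv_pow, mul_inv_cancel] at this
    rw [inv_pow, ← this, H.comm]
  have e3 : d 1 (g⁻¹ ^ n) = d 1 (g ^ n) := by rw [inv_pow, H.dist_one_inv inv]
  -- Translated by `g ^ n`, the bound `g2` controls the product of `1` and `g ^ n * x` at `g ^ n`.
  have h2 : lam (g ^ n) + lam x ≤ lam (g ^ n * x) + C := by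
    refine hC _ _ ?_
    simp only [gromovProd] at g2
    omega
  by_cases hsmall : d 1 (g ^ n) ≤ K' + δ
  · have h3 := hlam.lip_right 1 (g ^ n)
    rw [one_mul] at h3
    have h4 : (c : ℤ) * d 1 (g ^ n) ≤ c * (K' + δ).toNat := by
      gcongr
      omega
    zify
    have h5 : (0 : ℤ) ≤ lam (x⁻¹ * g ^ n * x) := by positivity
    have h6 : (0 : ℤ) ≤ C := by positivity
    linarith
  -- As `g ^ n` is long, `g ^ n * x` and `g ^ n` have a large product at `1`. So a large product of
  -- `x` with `g ^ n * x` would give one with `g ^ n`, against `g1`.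
  · have g3 : gromovProd d 1 x (g ^ n * x) ≤ K' + δ := by
      by_contra! hlt
      have := H.le_gromovProd_of_le (m := K' + δ + 1) (w := 1) (x := x) (y := g ^ n * x)
        (z := g ^ n) (by omega) (by
          have := H.comm (g ^ n * x) (g ^ n)
          simp only [gromovProd] at g2 ⊢
          omega)
      omega
    have h3 : lam x⁻¹ + lam (g ^ n * x) ≤ lam (x⁻¹ * (g ^ n * x)) + C := by
      refine hC _ _ ?_
      have e4 : d x (g ^ n * x) = d 1 (x⁻¹ * (g ^ n * x)) := by
        have := inv x 1 (x⁻¹ * (g ^ n * x))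
        rwa [mul_one, mul_inv_cancel_left] at this
      rw [H.dist_one_inv inv]
      simp only [gromovProd] at g3
      omega
    rw [← mul_assoc] at h3
    omega

end IsCombingLength

/-! ### Slim triangles and Cayley graphs -/

namespace SimpleGraph

variable {V : Type*} {X : SimpleGraph V}

theorem Walk.dist_getVert_of_geodesic (hX : X.Connected) {x y : V} {p : X.Walk x y}
    (hp : p.length = X.dist x y) {i : ℕ} (hi : i ≤ p.length) :
    X.dist x (p.getVert i) = i ∧ X.dist (p.getVert i) y = p.length - i := by
  have h1 := X.dist_le (p.take i)
  have h2 := X.dist_le (p.drop i)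
  have h3 := hX.dist_triangle (u := x) (v := p.getVert i) (w := y)
  rw [Walk.take_length] at h1
  rw [Walk.drop_length] at h2
  omega

theorem Walk.dist_add_dist_of_mem_support (hX : X.Connected) {x y u : V} {p : X.Walk x y}
    (hp : p.length = X.dist x y) (hu : u ∈ p.support) :
    X.dist x u + X.dist u y = X.dist x y := by
  obtain ⟨i, rfl, hi⟩ := Walk.mem_support_iff_exists_getVert.1 hu
  have := Walk.dist_getVert_of_geodesic hX hp hi
  omega

/-- In a graph with `δ`-slim triangles, a geodesic from `y` to `z` contains a vertex whose distance
from `x` is bounded by the Gromov product of `y` and `z` at `x`, up to an additive constant. -/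
theorem exists_mem_support_dist_le (hX : X.Connected) {δ : ℕ}
    (hδ : ∀ (x y z : V) (p : X.Walk x y) (q : X.Walk y z) (r : X.Walk x z),
      p.length = X.dist x y → q.length = X.dist y z → r.length = X.dist x z →
      ∀ u ∈ p.support, ∃ v, (v ∈ q.support ∨ v ∈ r.support) ∧ X.dist u v ≤ δ)
    (x : V) {y z : V} {p : X.Walk y z} (hp : p.length = X.dist y z) :
    ∃ u ∈ p.support, 2 * X.dist x u + X.dist y z ≤ X.dist x y + X.dist x z + 4 * δ + 2 := by
  classical
  obtain ⟨q, hq⟩ := hX.exists_walk_length_eq_dist z x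
  obtain ⟨r, hr⟩ := hX.exists_walk_length_eq_dist y x
  -- At the first vertex of `p` close to `q`, the preceding vertex is close to `r`, so this vertex
  -- is near both other sides.
  have hex : ∃ i, ∃ v ∈ q.support, X.dist (p.getVert i) v ≤ δ :=
    ⟨p.length, z, q.start_mem_support, by simp⟩
  set i := Nat.find hex with hi
  have hin : i ≤ p.length := Nat.find_min' hex ⟨z, q.start_mem_support, by simp⟩
  obtain ⟨v, hv, hvd⟩ := Nat.find_spec hex
  rw [← hi] at hvd
  obtain ⟨u, hu, hud⟩ : ∃ u ∈ r.support, X.dist (p.getVert (i - 1)) u ≤ δ := by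
    rcases Nat.eq_zero_or_pos i with h0 | h0
    · exact ⟨y, r.start_mem_support, by simp [h0]⟩
    · obtain ⟨u, hu | hu, hud⟩ := hδ y z x p q r hp hq hr _ (p.getVert_mem_support (i - 1))
      · exact absurd ⟨u, hu, hud⟩ (Nat.find_min hex (m := i - 1) (by omega))
      · exact ⟨u, hu, hud⟩
  have hv' := Walk.dist_add_dist_of_mem_support hX hq hv
  have hu' := Walk.dist_add_dist_of_mem_support hX hr hu
  have g1 := Walk.dist_getVert_of_geodesic hX hp hin
  have g2 := Walk.dist_getVert_of_geodesic hX hp (i := i - 1) (by omega)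
  have hstep : X.dist (p.getVert (i - 1)) (p.getVert i) ≤ 1 := by
    rcases Nat.eq_zero_or_pos i with h0 | h0
    · simp [h0]
    · have := p.adj_getVert_succ (i := i - 1) (by omega)
      rw [Nat.sub_add_cancel h0] at this
      exact (dist_eq_one_iff_adj.2 this).le
  refine ⟨p.getVert i, p.getVert_mem_support i, ?_⟩
  have t1 := hX.dist_triangle (u := x) (v := v) (w := p.getVert i)
  have t2 := hX.dist_triangle (u := z) (v := v) (w := p.getVert i)
  have t3 := hX.dist_triangle (u := x) (v := u) (w := p.getVert (i - 1))
  have t4 := hX.dist_triangle (u := y) (v := u) (w := p.getVert (i - 1))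
  have t5 := hX.dist_triangle (u := x) (v := p.getVert (i - 1)) (w := p.getVert i)
  have c1 := X.dist_comm (u := v) (v := p.getVert i)
  have c2 := X.dist_comm (u := u) (v := p.getVert (i - 1))
  have c3 := X.dist_comm (u := v) (v := x)
  have c4 := X.dist_comm (u := u) (v := x)
  have c5 := X.dist_comm (u := y) (v := x)
  have c6 := X.dist_comm (u := z) (v := x)
  have c7 := X.dist_comm (u := z) (v := p.getVert i)
  omega

theorem IsGromovHyperbolic.exists_isHyperbolicDist (h : X.IsGromovHyperbolic) :
    ∃ δ, IsHyperbolicDist (fun x y => (X.dist x y : ℤ)) δ := by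
  obtain ⟨hX, δ, hδ⟩ := h
  refine ⟨6 * δ + 2, fun x => by simp, fun x y => by simp [X.dist_comm], fun x y z => ?_,
    fun x y k hk hk' => ?_, fun w x y z => ?_⟩
  · exact_mod_cast hX.dist_triangle
  · lift k to ℕ using hk
    obtain ⟨p, hp⟩ := hX.exists_walk_length_eq_dist x y
    have := Walk.dist_getVert_of_geodesic hX hp (i := k) (by omega)
    exact ⟨p.getVert k, by omega, by omega⟩
  · obtain ⟨p, hp⟩ := hX.exists_walk_length_eq_dist x z
    obtain ⟨q, hq⟩ := hX.exists_walk_length_eq_dist z y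
    obtain ⟨r, hr⟩ := hX.exists_walk_length_eq_dist x y
    obtain ⟨u, hu, hwu⟩ := exists_mem_support_dist_le hX hδ w hp
    obtain ⟨v, hv, hvu⟩ := hδ x z y p q r hp hq hr u hu
    have t1 := hX.dist_triangle (u := w) (v := u) (w := v)
    have c1 := X.dist_comm (u := w) (v := x)
    have c2 := X.dist_comm (u := w) (v := y)
    have c3 := X.dist_comm (u := w) (v := z)
    have c4 := X.dist_comm (u := y) (v := z)
    have t2 := hX.dist_triangle (u := w) (v := v) (w := x)
    have t3 := hX.dist_triangle (u := w) (v := v) (w := y)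
    have t4 := hX.dist_triangle (u := w) (v := v) (w := z)
    have c5 := X.dist_comm (u := v) (v := x)
    have c6 := X.dist_comm (u := v) (v := z)
    rcases hv with hv | hv
    · have := Walk.dist_add_dist_of_mem_support hX hq hv
      right
      omega
    · have := Walk.dist_add_dist_of_mem_support hX hr hv
      left
      omega

variable {G : Type*} [Group G] {S : Set G}

theorem dist_mulCayley_mul_left (hS : (mulCayley S).Connected) (g x y : G) :
    (mulCayley S).dist (g * x) (g * y) = (mulCayley S).dist x y := by
  have key : ∀ g x y : G, (mulCayley S).dist (g * x) (g * y) ≤ (mulCayley S).dist x y := by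
    intro g x y
    obtain ⟨p, hp⟩ := hS.exists_walk_length_eq_dist x y
    let f : mulCayley S →g mulCayley S := ⟨(g * ·), fun h => mulCayley_adj_mul_iff_right.2 h⟩
    rw [← hp, ← Walk.length_map f p]
    exact dist_le _
  refine le_antisymm (key g x y) ?_
  simpa using key g⁻¹ (g * x) (g * y)

theorem exists_mulCayley_dist_eq (hS : (mulCayley S).Connected) {g : G} {n : ℕ}
    (hg : (mulCayley S).dist 1 g = n + 1) :
    ∃ h, (mulCayley S).dist 1 h = n ∧ (h⁻¹ * g ∈ S ∨ h⁻¹ * g ∈ S⁻¹) := by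
  obtain ⟨p, hp⟩ := hS.exists_walk_length_eq_dist 1 g
  have h1 := Walk.dist_getVert_of_geodesic hS hp (i := n) (by omega)
  have h2 := p.adj_getVert_succ (i := n) (by omega)
  rw [show n + 1 = p.length by omega, Walk.getVert_length] at h2
  refine ⟨p.getVert n, h1.1, ?_⟩
  simpa using ((mulCayley_adj S _ _).1 h2).2

theorem finite_ball_mulCayley (hS : (mulCayley S).Connected) (hfin : S.Finite) (R : ℕ) :
    {g | (mulCayley S).dist 1 g ≤ R}.Finite := by
  induction R with
  | zero =>
    refine (Set.finite_singleton (1 : G)).subset fun g hg => ?_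
    have h0 : (mulCayley S).dist 1 g = 0 := by simpa using hg
    exact ((hS.dist_eq_zero_iff).1 h0).symm
  | succ R ih =>
    open Pointwise in
    refine (ih.union (ih.mul (hfin.union hfin.inv))).subset fun g hg => ?_
    have hg' : (mulCayley S).dist 1 g ≤ R + 1 := hg
    rcases Nat.le_succ_iff.1 hg' with h | h
    · exact Or.inl h
    · obtain ⟨h, h1, h2⟩ := exists_mulCayley_dist_eq hS h
      exact Or.inr ⟨h, h1.le, h⁻¹ * g, h2, mul_inv_cancel_left _ _⟩

end SimpleGraph

/-! ### Completing subwords in regular languages -/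

namespace Language

/-- Prefixes of words of a regular language extend to words of the language by a bounded number of
letters. -/
theorem IsRegular.exists_bounded_suffix {A : Type*} {L : Language A} (hL : L.IsRegular) :
    ∃ s : ℕ, ∀ u z, u ++ z ∈ L → ∃ z' : List A, z'.length ≤ s ∧ u ++ z' ∈ L := by
  classical
  obtain ⟨σ, _, M, rfl⟩ := hL
  have hch : ∀ q : σ, ∃ y : List A, ∀ z, M.evalFrom q z ∈ M.accept → M.evalFrom q y ∈ M.accept := by
    intro q
    by_cases h : ∃ z, M.evalFrom q z ∈ M.accept
    · exact ⟨h.choose, fun _ _ => h.choose_spec⟩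
    · exact ⟨[], fun z hz => absurd ⟨z, hz⟩ h⟩
  choose y hy using hch
  refine ⟨Finset.univ.sup fun q => (y q).length, fun u z h => ⟨y (M.eval u), ?_, ?_⟩⟩
  · exact Finset.le_sup (f := fun q => (y q).length) (Finset.mem_univ _)
  · rw [DFA.mem_accepts, DFA.eval, DFA.evalFrom_of_append] at h ⊢
    exact hy _ _ h

/-- Suffixes of words of a regular language extend to words of the language by a bounded number of
letters. -/
theorem IsRegular.exists_bounded_prefix {A : Type*} {L : Language A} (hL : L.IsRegular) :
    ∃ s : ℕ, ∀ u z, u ++ z ∈ L → ∃ u' : List A, u'.length ≤ s ∧ u' ++ z ∈ L := by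
  classical
  obtain ⟨σ, _, M, rfl⟩ := hL
  have hch : ∀ q : σ, ∃ y : List A, ∀ u, M.eval u = q → M.eval y = q := by
    intro q
    by_cases h : ∃ u, M.eval u = q
    · exact ⟨h.choose, fun _ _ => h.choose_spec⟩
    · exact ⟨[], fun z hz => absurd ⟨z, hz⟩ h⟩
  choose y hy using hch
  refine ⟨Finset.univ.sup fun q => (y q).length, fun u z h => ⟨y (M.eval u), ?_, ?_⟩⟩
  · exact Finset.le_sup (f := fun q => (y q).length) (Finset.mem_univ _)
  · rw [DFA.mem_accepts, DFA.eval, DFA.evalFrom_of_append] at h ⊢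
    have : M.evalFrom M.start (y (M.evalFrom M.start u)) = M.evalFrom M.start u := hy _ u rfl
    rwa [this]

end Language

/-! ### Word lengths of a biautomatic structure -/

namespace Biautomatic

variable {G A : Type*} [Group G] {π : A → G} {L : Language A}

@[simp]
theorem label_nil : label π [] = 1 := rfl

@[simp]
theorem label_append (u v : List A) : label π (u ++ v) = label π u * label π v := by
  simp [label]

@[simp]
theorem label_cons (a : A) (v : List A) : label π (a :: v) = π a * label π v := by
  simp [label]

theorem connected_mulCayley_range (h : Function.Surjective (label π)) :
    (SimpleGraph.mulCayley (Set.range π)).Connected := by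
  have key : ∀ (w : List A) (g : G),
      (SimpleGraph.mulCayley (Set.range π)).Reachable g (g * label π w) := by
    intro w
    induction w with
    | nil => intro g; simp
    | cons a w ih =>
      intro g
      have h1 := ih (g * π a)
      rw [mul_assoc, ← label_cons] at h1
      refine SimpleGraph.Reachable.trans ?_ h1
      by_cases hg : g = g * π a
      · rw [← hg]
      · exact SimpleGraph.Adj.reachable ((SimpleGraph.mulCayley_adj _ _ _).2 ⟨hg, by simp⟩)
  have : Nonempty G := ⟨1⟩
  refine SimpleGraph.Connected.mk fun x y => ?_
  obtain ⟨w, hw⟩ := h (x⁻¹ * y)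
  have := key w x
  rwa [hw, mul_inv_cancel_left] at this

theorem cayDist_mul_right_le_one (x : G) (a : A) : cayDist π x (x * π a) ≤ 1 := by
  by_cases hg : x = x * π a
  · rw [← hg]; simp [cayDist]
  · exact (SimpleGraph.dist_eq_one_iff_adj.2
      ((SimpleGraph.mulCayley_adj _ _ _).2 ⟨hg, by simp⟩)).le

theorem wordLength_le {w : List A} (hw : w ∈ L) : wordLength π L (label π w) ≤ w.length :=
  Nat.sInf_le ⟨w, hw, rfl, rfl⟩

namespace IsBiautomaticStructure

variable [Finite A]

/-- Words of `L` whose paths start and end next to each other have almost the same length. -/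
theorem exists_length_le (hL : IsBiautomaticStructure π L) :
    ∃ C : ℕ, ∀ v ∈ L, ∀ w ∈ L, ∀ g h : G, cayDist π g h ≤ 1 →
      cayDist π (g * label π v) (h * label π w) ≤ 1 → w.length ≤ v.length + C := by
  classical
  obtain ⟨N, -, hN⟩ := hL.finite_to_one
  obtain ⟨ζ, -, hζ⟩ := hL.fellow_traveller
  obtain ⟨s, hs⟩ := hL.regular.exists_bounded_suffix
  have hconn := connected_mulCayley_range hL.surjective
  have hball := SimpleGraph.finite_ball_mulCayley hconn (Set.finite_range π) ζ
  have hwords : (label π '' {z : List A | z.length ≤ s}).Finite :=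
    (List.finite_length_le A s).image _
  obtain ⟨F, hF⟩ : ∃ F : Finset G, ∀ e, cayDist π 1 e ≤ ζ → ∀ z : List A, z.length ≤ s →
      e * label π z ∈ F := by
    refine ⟨(hball.image2 (· * ·) hwords).toFinset, fun e he z hz => ?_⟩
    rw [Set.Finite.mem_toFinset]
    exact Set.mem_image2_of_mem he ⟨z, hz, rfl⟩
  -- After time `v.length` the path of `w` stays within `ζ` of the end of the path of `v`. Prefixes
  -- of `w` cut every `s + 1` letters, completed in `L` by at most `s` letters, have distinct
  -- lengths; their endpoints relative to the end of `v` lie in `F`, each reached at most `N` times.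
  refine ⟨N * F.card * (s + 1), fun v hv w hw g h hgh hgh' => ?_⟩
  by_contra! hlen
  have hext : ∀ k, ∃ z : List A, z.length ≤ s ∧ w.take (v.length + k * (s + 1)) ++ z ∈ L :=
    fun k => hs _ (w.drop (v.length + k * (s + 1))) (by rwa [List.take_append_drop])
  choose z hz hzL using hext
  let word : ℕ → List A := fun k => w.take (v.length + k * (s + 1)) ++ z k
  have hk : ∀ k ∈ Finset.range (N * F.card + 1), v.length + k * (s + 1) ≤ w.length := by
    intro k hk
    have : k ≤ N * F.card := by simpa [Nat.lt_succ_iff] using hk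
    have := Nat.mul_le_mul_right (s + 1) this
    omega
  have hinj : Set.InjOn word (Finset.range (N * F.card + 1)) := by
    intro i hi j hj hij
    have e := congrArg List.length hij
    simp only [word, List.length_append, List.length_take, Nat.min_eq_left (hk i hi),
      Nat.min_eq_left (hk j hj)] at e
    have h1 := hz i
    have h2 := hz j
    rcases lt_trichotomy i j with h | h | h
    · have := Nat.mul_le_mul_right (s + 1) (Nat.succ_le_of_lt h)
      rw [Nat.succ_mul] at this
      omega
    · exact h
    · have := Nat.mul_le_mul_right (s + 1) (Nat.succ_le_of_lt h)
      rw [Nat.succ_mul] at this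
      omega
  have hcard := Finset.card_le_mul_card_image_of_maps_to
    (s := (Finset.range (N * F.card + 1)).image word) (t := F)
    (f := fun u => (g * label π v)⁻¹ * (h * label π u)) (by
      intro u hu
      obtain ⟨k, -, rfl⟩ := Finset.mem_image.1 hu
      have h1 := hζ v hv w hw g h hgh hgh' (v.length + k * (s + 1))
      rw [pathVertex, List.take_of_length_le (by omega), pathVertex, cayDist,
        ← SimpleGraph.dist_mulCayley_mul_left hconn (g * label π v)⁻¹, inv_mul_cancel] at h1
      have := hF _ h1 (z k) (hz k)
      simpa [word, mul_assoc] using this) N (by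
      intro b _
      have h1 := (hN (h⁻¹ * (g * label π v * b))).2
      rw [← Nat.cast_le (α := ℕ∞), ← Set.encard_coe_eq_coe_finsetCard]
      refine le_trans (Set.encard_le_encard fun u hu => ?_) h1
      obtain ⟨hu1, hu2⟩ := Finset.mem_filter.1 (Finset.mem_coe.1 hu)
      obtain ⟨k, -, rfl⟩ := Finset.mem_image.1 hu1
      refine ⟨hzL k, ?_⟩
      rw [← hu2]
      group)
  rw [Finset.card_image_of_injOn hinj, Finset.card_range] at hcard
  omega

theorem exists_mem_length_eq (hL : IsBiautomaticStructure π L) (g : G) :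
    ∃ w ∈ L, label π w = g ∧ w.length = wordLength π L g := by
  obtain ⟨N, -, hN⟩ := hL.finite_to_one
  obtain ⟨w, hw, hwg⟩ := Set.one_le_encard_iff_nonempty.1 (hN g).1
  exact Nat.sInf_mem (s := {n : ℕ | ∃ w ∈ L, label π w = g ∧ w.length = n})
    ⟨_, w, hw, hwg, rfl⟩

/-- Each letter of `u` costs one use of `exists_length_le`. On the right the two paths end at
neighbours; on the left one path starts at `π a` instead of `1`, which is where two-sided fellow
travelling enters. -/
theorem exists_wordLength_lipschitz (hL : IsBiautomaticStructure π L) :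
    ∃ C : ℕ, (∀ w ∈ L, w.length ≤ wordLength π L (label π w) + C) ∧
      (∀ (u : List A) (x : G), wordLength π L (x * label π u) ≤ wordLength π L x + C * u.length ∧
        wordLength π L x ≤ wordLength π L (x * label π u) + C * u.length) ∧
      ∀ (u : List A) (x : G), wordLength π L (label π u * x) ≤ wordLength π L x + C * u.length ∧
        wordLength π L x ≤ wordLength π L (label π u * x) + C * u.length := by
  obtain ⟨C, hC⟩ := hL.exists_length_le
  have hcomm : ∀ x y : G, cayDist π x y = cayDist π y x := fun x y => SimpleGraph.dist_comm
  have hself : ∀ x : G, cayDist π x x ≤ 1 := fun x => by simp [cayDist]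
  refine ⟨C, fun w hw => ?_, fun u => ?_, fun u => ?_⟩
  · obtain ⟨v, hv, hvw, hlen⟩ := hL.exists_mem_length_eq (label π w)
    rw [← hlen]
    exact hC v hv w hw 1 1 (hself _) (by rw [hvw]; exact hself _)
  · induction u with
    | nil => simp
    | cons a u ih =>
      intro x
      obtain ⟨v, hv, hvx, hlen⟩ := hL.exists_mem_length_eq x
      obtain ⟨w, hw, hwx, hlen'⟩ := hL.exists_mem_length_eq (x * π a)
      have hd := cayDist_mul_right_le_one (π := π) x a
      have h1 := hC v hv w hw 1 1 (hself _) (by rwa [hvx, hwx, one_mul, one_mul])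
      have h2 := hC w hw v hv 1 1 (hself _) (by rwa [hvx, hwx, one_mul, one_mul, hcomm])
      have h3 := ih (x * π a)
      rw [label_cons, List.length_cons, Nat.mul_succ, ← mul_assoc]
      omega
  · induction u with
    | nil => simp
    | cons a u ih =>
      intro x
      obtain ⟨v, hv, hvx, hlen⟩ := hL.exists_mem_length_eq (label π u * x)
      obtain ⟨w, hw, hwx, hlen'⟩ := hL.exists_mem_length_eq (π a * (label π u * x))
      have hd := cayDist_mul_right_le_one (π := π) 1 a
      rw [one_mul] at hd
      have h1 := hC v hv w hw (π a) 1 (by rwa [hcomm])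
        (by rw [hvx, hwx, one_mul]; exact hself _)
      have h2 := hC w hw v hv 1 (π a) hd (by rw [hvx, hwx, one_mul]; exact hself _)
      have h3 := ih x
      rw [label_cons, List.length_cons, Nat.mul_succ, mul_assoc]
      omega

/-- The length of a subword of a word of `L` is, up to a bounded error, the `L`-word length of the
element it represents. -/
theorem exists_length_subword (hL : IsBiautomaticStructure π L) :
    ∃ C : ℕ, ∀ u v z : List A, u ++ v ++ z ∈ L →
      v.length ≤ wordLength π L (label π v) + C ∧ wordLength π L (label π v) ≤ v.length + C := by
  obtain ⟨C, hC, hr, hl⟩ := hL.exists_wordLength_lipschitz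
  obtain ⟨s, hs⟩ := hL.regular.exists_bounded_suffix
  obtain ⟨s', hs'⟩ := hL.regular.exists_bounded_prefix
  refine ⟨C + s + s' + C * s + C * s', fun u v z h => ?_⟩
  obtain ⟨z', hz', h1⟩ := hs _ _ h
  rw [List.append_assoc] at h1
  obtain ⟨u', hu', h2⟩ := hs' _ _ h1
  have a1 := hC _ h2
  have a2 := wordLength_le (π := π) h2
  simp only [label_append, List.length_append] at a1 a2
  have a3 := hl u' (label π v * label π z')
  have a4 := hr z' (label π v)
  have a5 := Nat.mul_le_mul_left C hz'
  have a6 := Nat.mul_le_mul_left C hu'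
  omega

/-- With respect to any connected Cayley graph of finite valency, elements are represented by words
of linearly bounded length. -/
theorem exists_label_eq (hL : IsBiautomaticStructure π L) {S : Set G} (hS : S.Finite)
    (hconn : (SimpleGraph.mulCayley S).Connected) :
    ∃ c : ℕ, ∀ e : G, ∃ u : List A, label π u = e ∧
      u.length ≤ c * (SimpleGraph.mulCayley S).dist 1 e := by
  choose word hword using hL.surjective
  obtain ⟨c, hc⟩ := ((hS.union hS.inv).image fun x => (word x).length).bddAbove
  refine ⟨c, fun e => ?_⟩
  generalize hn : (SimpleGraph.mulCayley S).dist 1 e = n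
  induction n generalizing e with
  | zero => exact ⟨[], by simpa using hconn.dist_eq_zero_iff.1 hn, by simp⟩
  | succ n ih =>
    obtain ⟨h, h1, h2⟩ := SimpleGraph.exists_mulCayley_dist_eq hconn hn
    obtain ⟨u, hu, hlen⟩ := ih h h1
    refine ⟨u ++ word (h⁻¹ * e), by simp [hu, hword], ?_⟩
    have := hc ⟨h⁻¹ * e, h2, rfl⟩
    simp only [List.length_append, Nat.mul_succ] at *
    omega

/-- The path to `x` is traced by the prefixes of a shortest word of `L` for `x`. The constant adds
`C * k` for the Lipschitz bounds, `C'` for subwords and `B` for the `S`-length of a letter. -/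
theorem exists_isCombingLength (hL : IsBiautomaticStructure π L) {S : Set G} (hS : S.Finite)
    (hconn : (SimpleGraph.mulCayley S).Connected) :
    ∃ c : ℕ, IsCombingLength (fun x y => ((SimpleGraph.mulCayley S).dist x y : ℤ))
      (wordLength π L) c := by
  obtain ⟨C, -, hr, hl⟩ := hL.exists_wordLength_lipschitz
  obtain ⟨C', hsub⟩ := hL.exists_length_subword
  obtain ⟨k, hk⟩ := hL.exists_label_eq hS hconn
  obtain ⟨B, hB⟩ := (Set.finite_range fun a => (SimpleGraph.mulCayley S).dist 1 (π a)).bddAbove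
  refine ⟨C * k + C' + B, fun x e => ?_, fun x e => ?_, fun x => ?_⟩
  · obtain ⟨u, rfl, hu⟩ := hk e
    have h1 := (hr u x).1
    have h2 := Nat.mul_le_mul_left C hu
    norm_cast
    nlinarith [Nat.zero_le ((C' + B) * (SimpleGraph.mulCayley S).dist 1 (label π u))]
  · obtain ⟨u, rfl, hu⟩ := hk e
    have h1 := (hl u x).1
    have h2 := Nat.mul_le_mul_left C hu
    norm_cast
    nlinarith [Nat.zero_le ((C' + B) * (SimpleGraph.mulCayley S).dist 1 (label π u))]
  · obtain ⟨w, hw, hwx, -⟩ := hL.exists_mem_length_eq x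
    refine ⟨w.length, fun t => label π (w.take t), by simp, by simpa using hwx, fun t => ?_,
      fun s t hst ht => ?_⟩
    · norm_cast
      beta_reduce
      by_cases ht : t < w.length
      · rw [← List.take_concat_get' w t ht, label_append]
        have h1 := SimpleGraph.dist_mulCayley_mul_left hconn (label π (w.take t)) 1 (π w[t])
        have h2 := hB ⟨w[t], rfl⟩
        simp only [label_cons, label_nil, mul_one] at *
        omega
      · rw [List.take_of_length_le (by omega), List.take_of_length_le (by omega)]
        simp
    · have e1 : w.take t = w.take s ++ (w.take t).drop s := by
        conv_lhs => rw [← List.take_append_drop s (w.take t)]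
        rw [List.take_take, Nat.min_eq_left hst]
      have e2 : (label π (w.take s))⁻¹ * label π (w.take t) = label π ((w.take t).drop s) := by
        conv_lhs => rw [e1, label_append]
        rw [inv_mul_cancel_left]
      have h1 := hsub (w.take s) ((w.take t).drop s) (w.drop t) (by
        rwa [← e1, List.take_append_drop])
      rw [List.length_drop, List.length_take, Nat.min_eq_left ht] at h1
      simp only [e2]
      push_cast
      have : 0 ≤ (C : ℤ) * k := by positivity
      omega

end IsBiautomaticStructure

end Biautomatic

/-! ### Limits -/

/-- A sequence of linear growth that is superadditive up to a bounded error has a limit slope. -/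
theorem exists_tendsto_div_of_superadditive {f : ℕ → ℝ} {C B : ℝ}
    (hf : ∀ m n, f m + f n ≤ f (m + n) + C) (hB : ∀ n, f n ≤ B * n + B) (hB0 : 0 ≤ B)
    (hC : 0 ≤ C) : ∃ τ, Tendsto (fun n : ℕ => f n / n) atTop (𝓝 τ) := by
  -- Absorbing the error turns `C - f` into a subadditive sequence, to which Fekete's lemma applies.
  have hsub : Subadditive fun n => C - f n := fun m n => by
    have := hf m n
    linarith
  have hbdd : BddBelow (Set.range fun n : ℕ => (C - f n) / n) := by
    refine ⟨-(2 * B), ?_⟩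
    rintro _ ⟨n, rfl⟩
    rcases Nat.eq_zero_or_pos n with rfl | hn
    · simp [hB0]
    · have hn' : (1 : ℝ) ≤ n := by exact_mod_cast hn
      have h1 := hB n
      simp only
      rw [le_div_iff₀ (by linarith)]
      nlinarith
  have h1 := hsub.tendsto_lim hbdd
  have h2 := (tendsto_const_div_atTop_nhds_zero_nat C).sub h1
  refine ⟨_, h2.congr fun n => ?_⟩
  ring

theorem mainTheorem8 {G A : Type*} [Group G] [Finite A] (π : A → G) (L : Language A)
    (hG : IsHyperbolicGroup G) (hL : Biautomatic.IsBiautomaticStructure π L) (g : G) :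
    Tendsto (fun n : ℕ => (Biautomatic.wordLength π L (g ^ n) : ℝ) / n) atTop
        (𝓝 (Biautomatic.stableWordLength π L g)) ∧
      Tendsto (fun n : ℕ => (Biautomatic.conjWordLength π L (g ^ n) : ℝ) / n) atTop
        (𝓝 (Biautomatic.stableWordLength π L g)) := by
  obtain ⟨S, hS, -, hyp⟩ := hG
  have hconn := hyp.1
  obtain ⟨δ, H⟩ := hyp.exists_isHyperbolicDist
  obtain ⟨c, hlam⟩ := hL.exists_isCombingLength hS hconn
  have inv : ∀ g x y : G, ((SimpleGraph.mulCayley S).dist (g * x) (g * y) : ℤ) =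
      (SimpleGraph.mulCayley S).dist x y := fun g x y => by
    rw [SimpleGraph.dist_mulCayley_mul_left hconn]
  have fin : ∀ R : ℤ, {g : G | ((SimpleGraph.mulCayley S).dist 1 g : ℤ) ≤ R}.Finite := fun R =>
    (SimpleGraph.finite_ball_mulCayley hconn hS R.toNat).subset fun g hg => by
      have hg' : ((SimpleGraph.mulCayley S).dist 1 g : ℤ) ≤ R := hg
      change (SimpleGraph.mulCayley S).dist 1 g ≤ R.toNat
      omega
  obtain ⟨C, hC⟩ := hlam.exists_pow_add_le H inv fin g
  obtain ⟨C', hC'⟩ := hlam.exists_pow_le_conj H inv fin g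
  obtain ⟨τ, hτ⟩ : ∃ τ, Tendsto (fun n : ℕ => (Biautomatic.wordLength π L (g ^ n) : ℝ) / n) atTop
      (𝓝 τ) := by
    set b := (SimpleGraph.mulCayley S).dist 1 g with hb
    refine exists_tendsto_div_of_superadditive (C := C)
      (B := (Biautomatic.wordLength π L 1 + c * b : ℕ)) (fun m n => by exact_mod_cast hC m n)
      (fun n => ?_) (by positivity) (by positivity)
    have h1 := hlam.lip_right 1 (g ^ n)
    have h2 := H.dist_one_pow_le inv g n
    rw [one_mul] at h1
    norm_cast at h1 h2 ⊢
    have h3 := Nat.mul_le_mul_left c h2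
    rw [← hb] at h3
    nlinarith [Nat.zero_le (Biautomatic.wordLength π L 1 * n), Nat.zero_le (c * b)]
  have hst : Biautomatic.stableWordLength π L g = τ := hτ.limUnder_eq
  rw [hst]
  refine ⟨hτ, ?_⟩
  have hlow : Tendsto (fun n : ℕ => (Biautomatic.wordLength π L (g ^ n) : ℝ) / n - C' / n) atTop
      (𝓝 τ) := by
    simpa using hτ.sub (tendsto_const_div_atTop_nhds_zero_nat (C' : ℝ))
  refine tendsto_of_tendsto_of_tendsto_of_le_of_le hlow hτ (fun n => ?_) (fun n => ?_)
  -- The infimum over conjugates is attained, being taken over natural numbers, and `C'` does not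
  -- depend on `h`.
  · obtain ⟨h, hh⟩ : ∃ h, Biautomatic.wordLength π L (h * g ^ n * h⁻¹) =
        Biautomatic.conjWordLength π L (g ^ n) :=
      Nat.sInf_mem (Set.range_nonempty fun h : G => Biautomatic.wordLength π L (h * g ^ n * h⁻¹))
    have h1 : (Biautomatic.wordLength π L (g ^ n) : ℝ) ≤
        Biautomatic.conjWordLength π L (g ^ n) + C' := by
      exact_mod_cast hh ▸ hC' n h
    simp only
    rw [← sub_div]
    gcongr
    linarith
  · have h1 : Biautomatic.conjWordLength π L (g ^ n) ≤ Biautomatic.wordLength π L (g ^ n) :=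
      Nat.sInf_le ⟨1, by simp⟩
    simp only
    gcongr
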